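/- Let $k$ be a field that is complete with respect to a non-Archimedean absolute value $|\cdot|$ (possibly trivial). Let $M$ be the character lattice of a split torus $T\simeq\mathbb{G}_m^n$ over $k$, let $N$ be its dual lattice and $N_{\mathbb R}=N\otimes\mathbb R$. Let $X=X(\Delta)$ be the toric variety of a rational polyhedral fan $\Delta$ of strongly convex cones in $N_{\mathbb R}$, which is covered by the affine charts $U_\sigma=\operatorname{Spec}k[S_\sigma]$, $\sigma\in\Delta$, with $S_\sigma=\sigma^\vee\cap M$. Write $\chi^s$ for the monomial of $s\in S_\sigma$. The (topological space underlying the) Berkovich analytification $X^{an}$ is glued, along the inclusions of cones of $\Delta$, from the spaces $U_\sigma^{an}$ of multiplicative seminorms $f\mapsto|f|_x$ on $k[S_\sigma]$ extending the absolute value of $k$, each with the topology of pointwise convergence. In the same way, $N_{\mathbb R}(\Delta)$ is glued from the spaces $N_{\mathbb R}(\sigma)=\operatorname{Hom}(S_\sigma,\overline{\mathbb R})$ of monoid homomorphisms to $\overline{\mathbb R}=(\mathbb R\cup\{\infty\},+)$, each with the topology of pointwise convergence. The tropicalization map $\operatorname{trop}_\Delta:X^{an}\to N_{\mathbb R}(\Delta)$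 sends $x\in U_\sigma^{an}$ to the homomorphism $s\mapsto-\log|\chi^s|_x$ in $N_{\mathbb R}(\sigma)$. **Lemma 4.1.** There are a closed subset $\mathfrak S(X)\subseteq X^{an}$, a continuous map $\mathbf p_\Delta:X^{an}\to X^{an}$ and a homeomorphism $J_\Delta:N_{\mathbb R}(\Delta)\to\mathfrak S(X)$ such that: 1. $\mathbf p_\Delta$ is a strong deformation retraction onto $\mathfrak S(X)$: its image is $\mathfrak S(X)$, and there is a continuous map $H:[0,1]\times X^{an}\to X^{an}$ with $H(0,x)=x$ and $H(1,x)=\mathbf p_\Delta(x)$ for all $x\in X^{an}$, and $H(t,x)=x$ for all $t\in[0,1]$ and $x\in\mathfrak S(X)$; 2. $J_\Delta\circ\operatorname{trop}_\Delta=\mathbf p_\Delta$; 3. for every $\sigma\in\Delta$ the map $\mathbf p_\Delta$ sends $U_\sigma^{an}$ to itself, and for $x\in U_\sigma^{an}$ the seminorm $\mathbf p_\Delta(x)=\mathbf p_\sigma(x)$ is given by $$\mathbf p_\sigma(x)(f)=\max_{s\in S_\sigma}|a_s|\,|\chi^s|_x\qquad\text{for } f=\sum_{s\in S_\sigma}a_s\chi^s\in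 k[S_\sigma].$$ -/

import Mathlib

noncomputable section

namespace Toric

/-! ### Lattices, cones and fans

`M` is the character lattice of a split torus, `N` its dual lattice. -/

/-- The cocharacter lattice `N`, the dual of the character lattice `M`. -/
abbrev Cochar (M : Type*) [AddCommGroup M] : Type _ := M →+ ℤ

/-- The real vector space `N_ℝ = N ⊗ ℝ`, realised as `Hom(M, ℝ)`. -/
abbrev NReal (M : Type*) [AddCommGroup M] : Type _ := M →+ ℝ

/-- The inclusion of the lattice `N` into `N_ℝ`. -/
def Cochar.toReal {M : Type*} [AddCommGroup M] (v : Cochar M) : NReal M :=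
  (Int.castAddHom ℝ).comp v

/-- The monoid `S_σ = σ^∨ ∩ M` of characters that are non-negative on `σ`. -/
def dualMonoid {M : Type*} [AddCommGroup M] (σ : PointedCone ℝ (NReal M)) : AddSubmonoid M where
  carrier := {m | ∀ u ∈ σ, 0 ≤ u m}
  zero_mem' := fun u _ => by simp
  add_mem' := fun {a b} ha hb u hu => by
    simpa using add_nonneg (ha u hu) (hb u hu)

lemma dualMonoid_anti {M : Type*} [AddCommGroup M] {τ σ : PointedCone ℝ (NReal M)}
    (h : τ ≤ σ) : dualMonoid σ ≤ dualMonoid τ :=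
  fun _ hm u hu => hm u (h hu)

/-- A cone is rational polyhedral if it is generated by finitely many elements of `N`. -/
def IsRationalPolyhedral {M : Type*} [AddCommGroup M] (σ : PointedCone ℝ (NReal M)) : Prop :=
  ∃ G : Finset (Cochar M), σ = PointedCone.hull ℝ (Cochar.toReal '' (G : Set (Cochar M)))

/-- A cone is strongly convex if it contains no line. -/
def IsStronglyConvex {M : Type*} [AddCommGroup M] (σ : PointedCone ℝ (NReal M)) : Prop :=
  ∀ u ∈ σ, -u ∈ σ → u = 0

/-- `τ` is a face of the rational polyhedral cone `σ`: `τ = σ ∩ m^⊥` for some `m ∈ S_σ`.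
(For a rational polyhedral cone every supporting hyperplane cuts out a face of this form.) -/
def IsFace {M : Type*} [AddCommGroup M] (τ σ : PointedCone ℝ (NReal M)) : Prop :=
  ∃ m ∈ dualMonoid σ, ∀ u : NReal M, u ∈ τ ↔ u ∈ σ ∧ u m = 0

/-- A rational polyhedral fan in `N_ℝ`. Finiteness of the set of cones is not imposed. -/
structure Fan (M : Type*) [AddCommGroup M] where
  cones : Set (PointedCone ℝ (NReal M))
  rational : ∀ σ ∈ cones, IsRationalPolyhedral σ
  stronglyConvex : ∀ σ ∈ cones, IsStronglyConvex σ
  face_mem : ∀ σ ∈ cones, ∀ τ, IsFace τ σ → τ ∈ cones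
  inter_face : ∀ σ ∈ cones, ∀ τ ∈ cones, IsFace (σ ⊓ τ) σ ∧ IsFace (σ ⊓ τ) τ

/-! ### Berkovich analytification of affine schemes -/

/-- The underlying set of the Berkovich analytification of `Spec A`: multiplicative seminorms on
the `k`-algebra `A` that restrict to the given norm on `k`. -/
def AffineAn (k A : Type*) [NormedField k] [CommRing A] [Algebra k A] : Type _ :=
  {x : MulRingSeminorm A // ∀ a : k, x (algebraMap k A a) = ‖a‖}

namespace AffineAn

variable {k A B : Type*} [NormedField k] [CommRing A] [Algebra k A] [CommRing B] [Algebra k B]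

/-- The value `|f|_x` of a function `f` at the point `x`. -/
def val (x : AffineAn k A) (f : A) : ℝ := x.1 f

/-- The weakest topology for which `x ↦ |f|_x` is continuous for every `f`. -/
instance : TopologicalSpace (AffineAn k A) :=
  TopologicalSpace.induced val inferInstance

/-- The map of analytifications induced by a homomorphism of `k`-algebras. -/
def comap (φ : A →ₐ[k] B) (x : AffineAn k B) : AffineAn k A :=
  ⟨{ toFun := fun f => x.1 (φ f)
     map_zero' := by simp
     add_le' := fun f g => by simpa using map_add_le_add x.1 (φ f) (φ g)
     neg' := fun f => by simp
     map_one' := by simp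
     map_mul' := fun f g => by simp },
   fun a => (congrArg x.1 (φ.commutes a)).trans (x.2 a)⟩

end AffineAn

/-! ### The analytic toric variety -/

/-- The coordinate ring `k[S_σ]` of the affine toric variety `U_σ`. -/
abbrev CoordRing (k : Type*) [NormedField k] {M : Type*} [AddCommGroup M]
    (σ : PointedCone ℝ (NReal M)) : Type _ :=
  AddMonoidAlgebra k (dualMonoid σ)

/-- The character `χ^s` as an element of `k[S_σ]`. -/
def chi (k : Type*) [NormedField k] {M : Type*} [AddCommGroup M]
    {σ : PointedCone ℝ (NReal M)} (s : dualMonoid σ) : CoordRing k σ :=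
  AddMonoidAlgebra.single s 1

/-- The analytification `U_σ^an` of `U_σ = Spec k[S_σ]`. -/
abbrev UAn (k : Type*) [NormedField k] {M : Type*} [AddCommGroup M]
    (σ : PointedCone ℝ (NReal M)) : Type _ :=
  AffineAn k (CoordRing k σ)

/-- For `τ ⊆ σ`, the inclusion `k[S_σ] → k[S_τ]`. -/
def coordIncl (k : Type*) [NormedField k] {M : Type*} [AddCommGroup M]
    {τ σ : PointedCone ℝ (NReal M)} (h : τ ≤ σ) : CoordRing k σ →ₐ[k] CoordRing k τ :=
  AddMonoidAlgebra.mapDomainAlgHom k k (AddSubmonoid.inclusion (dualMonoid_anti h))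

/-- For `τ ⊆ σ`, the map `U_τ^an → U_σ^an`. -/
def UAn.incl {k : Type*} [NormedField k] {M : Type*} [AddCommGroup M]
    {τ σ : PointedCone ℝ (NReal M)} (h : τ ≤ σ) : UAn k τ → UAn k σ :=
  AffineAn.comap (coordIncl k h)

/-- Two points `x ∈ U_σ^an`, `y ∈ U_τ^an` are glued if they both come from a point of `U_ρ^an`
for a cone `ρ` of the fan with `ρ ⊆ σ` and `ρ ⊆ τ`. -/
def XAn.Rel (k : Type*) [NormedField k] {M : Type*} [AddCommGroup M] (Δ : Fan M)
    (a b : Σ σ : Δ.cones, UAn k σ.1) : Prop :=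
  ∃ (ρ : Δ.cones) (h₁ : ρ.1 ≤ a.1.1) (h₂ : ρ.1 ≤ b.1.1) (z : UAn k ρ.1),
    a.2 = UAn.incl h₁ z ∧ b.2 = UAn.incl h₂ z

/-- The topological space underlying the analytification `X^an` of the toric variety
`X = X(Δ)`, obtained by gluing the spaces `U_σ^an`, `σ ∈ Δ`. -/
def XAn (k : Type*) [NormedField k] {M : Type*} [AddCommGroup M] (Δ : Fan M) : Type _ :=
  Quot (XAn.Rel k Δ)

/-- The quotient topology. -/
instance (k : Type*) [NormedField k] {M : Type*} [AddCommGroup M] (Δ : Fan M) :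
    TopologicalSpace (XAn k Δ) :=
  inferInstanceAs (TopologicalSpace (Quot (XAn.Rel k Δ)))

/-- The chart `U_σ^an → X^an`. -/
def XAn.chart {k : Type*} [NormedField k] {M : Type*} [AddCommGroup M] {Δ : Fan M}
    (σ : Δ.cones) (x : UAn k σ.1) : XAn k Δ :=
  Quot.mk _ ⟨σ, x⟩

/-! ### The partial compactification of `N_ℝ` -/

/-- `N_ℝ(σ) = Hom(S_σ, ℝ ∪ {∞})`, homomorphisms of monoids. -/
def NRCone {M : Type*} [AddCommGroup M] (σ : PointedCone ℝ (NReal M)) : Type _ :=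
  dualMonoid σ →+ WithTop ℝ

/-- The topology of pointwise convergence; `ℝ ∪ {∞}` carries the order topology. -/
instance {M : Type*} [AddCommGroup M] (σ : PointedCone ℝ (NReal M)) :
    TopologicalSpace (NRCone σ) :=
  TopologicalSpace.induced (fun (u : dualMonoid σ →+ WithTop ℝ) (s : dualMonoid σ) => u s)
    inferInstance

/-- For `τ ⊆ σ`, the map `N_ℝ(τ) → N_ℝ(σ)` given by restriction to `S_σ ⊆ S_τ`. -/
def NRCone.incl {M : Type*} [AddCommGroup M] {τ σ : PointedCone ℝ (NReal M)} (h : τ ≤ σ)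
    (u : NRCone τ) : NRCone σ :=
  AddMonoidHom.comp u (AddSubmonoid.inclusion (dualMonoid_anti h))

/-- The gluing relation between the `N_ℝ(σ)`, as for the `U_σ^an`. -/
def NR.Rel {M : Type*} [AddCommGroup M] (Δ : Fan M) (a b : Σ σ : Δ.cones, NRCone σ.1) : Prop :=
  ∃ (ρ : Δ.cones) (h₁ : ρ.1 ≤ a.1.1) (h₂ : ρ.1 ≤ b.1.1) (w : NRCone ρ.1),
    a.2 = NRCone.incl h₁ w ∧ b.2 = NRCone.incl h₂ w

/-- The partial compactification `N_ℝ(Δ)`, obtained by gluing the `N_ℝ(σ)`, `σ ∈ Δ`. -/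
def NR {M : Type*} [AddCommGroup M] (Δ : Fan M) : Type _ := Quot (NR.Rel Δ)

/-- The quotient topology. -/
instance {M : Type*} [AddCommGroup M] (Δ : Fan M) : TopologicalSpace (NR Δ) :=
  inferInstanceAs (TopologicalSpace (Quot (NR.Rel Δ)))

/-! ### Tropicalization -/

/-- The map `-log : [0, ∞) → ℝ ∪ {∞}`, with `-log 0 = ∞`. -/
def negLog (r : ℝ) : WithTop ℝ := if r = 0 then ⊤ else ((-Real.log r : ℝ) : WithTop ℝ)

lemma negLog_mul (r s : ℝ) : negLog (r * s) = negLog r + negLog s := by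
  unfold negLog
  by_cases hr : r = 0
  · simp [hr]
  by_cases hs : s = 0
  · simp [hs]
  rw [if_neg (mul_ne_zero hr hs), if_neg hr, if_neg hs, Real.log_mul hr hs, neg_add,
    WithTop.coe_add]

/-- The map `trop_σ : U_σ^an → N_ℝ(σ)`, `x ↦ (s ↦ -log |χ^s|_x)`. -/
def tropCone {k : Type*} [NormedField k] {M : Type*} [AddCommGroup M]
    {σ : PointedCone ℝ (NReal M)} (x : UAn k σ) : NRCone σ where
  toFun := fun s => negLog (x.val (chi k s))
  map_zero' := by
    have h : x.val (chi k (0 : dualMonoid σ)) = 1 := map_one x.1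
    simp [h, negLog]
  map_add' := fun s t => by
    have h : x.val (chi k (s + t)) = x.val (chi k s) * x.val (chi k t) := by
      have h' : chi k (s + t) = chi k s * chi k t := by
        simp [chi, AddMonoidAlgebra.single_mul_single]
      rw [h']
      exact map_mul x.1 _ _
    rw [h, negLog_mul]

lemma tropCone_incl {k : Type*} [NormedField k] {M : Type*} [AddCommGroup M]
    {τ σ : PointedCone ℝ (NReal M)} (h : τ ≤ σ) (z : UAn k τ) :
    tropCone (UAn.incl h z) = NRCone.incl h (tropCone z) := by
  refine AddMonoidHom.ext fun s => ?_
  change negLog (z.1 (coordIncl k h (chi k s))) = negLog (z.1 (chi k _))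
  simp [coordIncl, chi]

/-- The tropicalization map `trop_Δ : X^an → N_ℝ(Δ)`, given on each chart by `trop_σ`. -/
def trop {k : Type*} [NormedField k] {M : Type*} [AddCommGroup M] {Δ : Fan M} :
    XAn k Δ → NR Δ :=
  Quot.map (fun a => ⟨a.1, tropCone a.2⟩) (by
    rintro ⟨σ, x⟩ ⟨τ, y⟩ ⟨ρ, h₁, h₂, z, hx, hy⟩
    refine ⟨ρ, h₁, h₂, tropCone z, ?_, ?_⟩
    · exact (congrArg tropCone hx).trans (tropCone_incl h₁ z)
    · exact (congrArg tropCone hy).trans (tropCone_incl h₂ z))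

/-! ### Strong deformation retractions -/

/-- The continuous map `p : X → X` is a strong deformation retraction onto the subset `S`: its image
is `S` and it is homotopic to the identity through maps that fix `S` pointwise at all times. -/
def IsStrongDeformationRetraction {X : Type*} [TopologicalSpace X] (p : C(X, X)) (S : Set X) :
    Prop :=
  Set.range p = S ∧ (ContinuousMap.id X).HomotopicRel p S

end Toric

end

/-!
The retraction sends a point `x` of `U_σ^an` to the Gauss point `∑ aₛ χˢ ↦ maxₛ |aₛ| |χˢ|_x`, which
depends only on the tropicalization of `x`. So there are three things to show: Gauss points exist
for all `u` in `N_ℝ(σ)`, they form a closed set, and `x` can be joined to its Gauss point by a path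
that is continuous in `x`.

*Gauss points.* For an ultrametric valuation on the coefficients and a multiplicative weight on the
exponents, the Gauss norm on a monoid algebra is multiplicative as soon as the monoid has unique
sums (`AddMonoidAlgebra.gaussNorm_mul`), which holds for submonoids of a lattice. This gives a
continuous section `gaussSection` of the tropicalization map, and hence a homeomorphism of
`N_ℝ(Δ)` onto the set of Gauss points, whose inverse is the tropicalization map.

*Closedness.* A cone of the fan contained in another one is a face of it, so that the inclusion of
charts comes from a localization at a character and is injective
(`incl_injective_of_isFace`). Being a Gauss point is therefore independent of the chart, and in each
chart it is the closed condition `gaussPoint (tropCone x) = x`.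

*The homotopy.* At time `t` the polydisc of radius `t` around the identity of the torus acts on `x`.
In coordinates, `f = ∑ aₛ χˢ` is sent to `∑ aₛ χˢ (1 + y) ^ s`, and the value at time `t` is the
Gauss norm of this element with respect to `|·|_x` on the coefficients and radius `t` in the
variables `y`. Since `1 + y` has norm `1`, multiplying by a power of it to remove the negative
exponents changes nothing (`AddMonoidAlgebra.flow`). At `t = 0` only the constant term `f` counts.
At `t = 1` the Gauss norm is invariant under the translation `y ↦ y - 1`, which turns `(1 + y) ^ s`
into the monomial `y ^ s`; as `s ↦ y ^ s` is injective, the coefficients are then the single terms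
`aₛ χˢ` (`AddMonoidAlgebra.flow_one`). The value grows with `t`, so that Gauss points, where the two
ends agree, do not move. The flow commutes with the inclusions of charts, and gluing uses that
`[0,1]` is locally compact.
-/

noncomputable section

open scoped NNReal

/-! ### Gauss valuations on monoid algebras -/

namespace AddMonoidAlgebra

variable {A B S : Type*} [CommRing A] [CommRing B]

/-- The weighted Gauss norm `f = ∑ aₛ χˢ ↦ maxₛ v(aₛ) w(s)` on a monoid algebra. -/
def gaussNorm (v : Valuation A ℝ≥0) (w : S → ℝ≥0) (f : AddMonoidAlgebra A S) : ℝ≥0 :=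
  f.coeff.support.sup fun s => v (f.coeff s) * w s

lemma le_gaussNorm (v : Valuation A ℝ≥0) (w : S → ℝ≥0) (f : AddMonoidAlgebra A S) (s : S) :
    v (f.coeff s) * w s ≤ gaussNorm v w f := by
  by_cases h : f.coeff s = 0
  · simp [h]
  · exact Finset.le_sup (f := fun s => v (f.coeff s) * w s) (Finsupp.mem_support_iff.2 h)

lemma gaussNorm_le_iff {v : Valuation A ℝ≥0} {w : S → ℝ≥0} {f : AddMonoidAlgebra A S}
    {c : ℝ≥0} : gaussNorm v w f ≤ c ↔ ∀ s, v (f.coeff s) * w s ≤ c :=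
  ⟨fun h s => (le_gaussNorm v w f s).trans h, fun h => Finset.sup_le fun s _ => h s⟩

lemma isGreatest_gaussNorm [Nonempty S] (v : Valuation A ℝ≥0) (w : S → ℝ≥0)
    (f : AddMonoidAlgebra A S) :
    IsGreatest (Set.range fun s => v (f.coeff s) * w s) (gaussNorm v w f) := by
  refine ⟨?_, by rintro _ ⟨s, rfl⟩; exact le_gaussNorm v w f s⟩
  rcases f.coeff.support.eq_empty_or_nonempty with h | h
  · obtain ⟨s⟩ := ‹Nonempty S›
    have h0 : f.coeff = 0 := Finsupp.support_eq_empty.1 h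
    exact ⟨s, by simp [gaussNorm, h0]⟩
  · obtain ⟨s, -, hs⟩ := Finset.exists_mem_eq_sup _ h fun s => v (f.coeff s) * w s
    exact ⟨s, hs.symm⟩

lemma gaussNorm_single (v : Valuation A ℝ≥0) (w : S → ℝ≥0) (s : S) (a : A) :
    gaussNorm v w (single s a) = v a * w s := by
  refine le_antisymm (gaussNorm_le_iff.2 fun s' => ?_) ?_
  · by_cases h : s = s'
    · simp [h]
    · simp [h]
  · simpa using le_gaussNorm v w (single s a) s

lemma gaussNorm_add_le_max (v : Valuation A ℝ≥0) (w : S → ℝ≥0) (f g : AddMonoidAlgebra A S) :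
    gaussNorm v w (f + g) ≤ max (gaussNorm v w f) (gaussNorm v w g) := by
  refine gaussNorm_le_iff.2 fun s => ?_
  refine (mul_le_mul_left (v.map_add (f.coeff s) (g.coeff s)) (w s)).trans ?_
  rw [max_mul]
  exact max_le_max (le_gaussNorm v w f s) (le_gaussNorm v w g s)

lemma gaussNorm_sum_le (v : Valuation A ℝ≥0) (w : S → ℝ≥0) {ι : Type*} (t : Finset ι)
    (f : ι → AddMonoidAlgebra A S) {c : ℝ≥0} (h : ∀ i ∈ t, gaussNorm v w (f i) ≤ c) :
    gaussNorm v w (∑ i ∈ t, f i) ≤ c := by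
  classical
  induction t using Finset.induction_on with
  | empty => simp [gaussNorm]
  | insert i t hi ih =>
    rw [Finset.sum_insert hi]
    exact (gaussNorm_add_le_max v w _ _).trans
      (max_le (h i (by simp)) (ih fun j hj => h j (by simp [hj])))

lemma gaussNorm_mono (v : Valuation A ℝ≥0) {w w' : S → ℝ≥0} (h : w ≤ w')
    (f : AddMonoidAlgebra A S) : gaussNorm v w f ≤ gaussNorm v w' f :=
  gaussNorm_le_iff.2 fun s => (mul_le_mul_right (h s) _).trans (le_gaussNorm v w' f s)

/-- Multiplicativity of the Gauss norm. Among the pairs of exponents at which `f` and `g` attain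
their norms there is one whose sum is attained only once, because `S` has unique sums; the
corresponding coefficient of `f * g` has a single dominant term. -/
lemma gaussNorm_mul [AddMonoid S] [UniqueSums S] (v : Valuation A ℝ≥0)
    (w : Multiplicative S →* ℝ≥0) (f g : AddMonoidAlgebra A S) :
    gaussNorm v (fun s => w (.ofAdd s)) (f * g) =
      gaussNorm v (fun s => w (.ofAdd s)) f * gaussNorm v (fun s => w (.ofAdd s)) g := by
  classical
  set W : S → ℝ≥0 := fun s => w (.ofAdd s) with hW
  have hadd : ∀ a b, W (a + b) = W a * W b := fun a b => by simp [hW, ofAdd_add]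
  refine le_antisymm ?_ ?_
  · rw [mul_def]
    refine gaussNorm_sum_le v W _ _ fun a _ => gaussNorm_sum_le v W _ _ fun b _ => ?_
    rw [gaussNorm_single, map_mul, hadd, mul_mul_mul_comm]
    exact mul_le_mul' (le_gaussNorm v W f a) (le_gaussNorm v W g b)
  · by_cases h0 : gaussNorm v W f * gaussNorm v W g = 0
    · simp [h0]
    have hpos := pos_iff_ne_zero.2 h0
    have hf0 := left_ne_zero_of_mul h0
    have hg0 := right_ne_zero_of_mul h0
    have key : ∀ q : AddMonoidAlgebra A S, gaussNorm v W q ≠ 0 →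
        (q.coeff.support.filter fun s => v (q.coeff s) * W s = gaussNorm v W q).Nonempty := by
      intro q hq
      obtain ⟨s, hs⟩ := (isGreatest_gaussNorm v W q).1
      refine ⟨s, Finset.mem_filter.2 ⟨Finsupp.mem_support_iff.2 fun h => hq ?_, hs⟩⟩
      rw [← hs]
      simp [h]
    obtain ⟨a₀, ha₀, b₀, hb₀, huniq⟩ :=
      UniqueSums.uniqueAdd_of_nonempty (key f hf0) (key g hg0)
    rw [Finset.mem_filter] at ha₀ hb₀
    have hmain : v (f.coeff a₀ * g.coeff b₀) * W (a₀ + b₀) =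
        gaussNorm v W f * gaussNorm v W g := by
      rw [map_mul, hadd, mul_mul_mul_comm, ha₀.2, hb₀.2]
    have hcoeff : (f * g).coeff (a₀ + b₀) = ∑ p ∈ f.coeff.support ×ˢ g.coeff.support,
        if p.1 + p.2 = a₀ + b₀ then f.coeff p.1 * g.coeff p.2 else 0 := by
      rw [coeff_mul, Finset.sum_product]
      rfl
    have hdom : v ((f * g).coeff (a₀ + b₀)) = v (f.coeff a₀ * g.coeff b₀) := by
      rw [hcoeff]
      refine (IsNonarchimedean.apply_sum_eq_of_lt (f := v) (k := (a₀, b₀)) v.map_add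
        (fun a => (v.map_neg a).symm) (Finset.mk_mem_product ha₀.1 hb₀.1) ?_).trans (by simp)
      rintro ⟨a, b⟩ hab hne
      rw [Finset.mem_product] at hab
      rw [if_pos rfl]
      have hWpos : 0 < W (a₀ + b₀) := pos_iff_ne_zero.2 fun h => h0 (by rw [← hmain, h, mul_zero])
      refine lt_of_mul_lt_mul_right (a := W (a₀ + b₀)) ?_ zero_le
      rw [hmain]
      dsimp only
      split_ifs with hsum
      · rw [← hsum, map_mul, hadd, mul_mul_mul_comm]
        by_cases ha : v (f.coeff a) * W a = gaussNorm v W f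
        · have hb : v (g.coeff b) * W b ≠ gaussNorm v W g := fun hb => hne <| by
            have := huniq (Finset.mem_filter.2 ⟨hab.1, ha⟩) (Finset.mem_filter.2 ⟨hab.2, hb⟩) hsum
            exact Prod.ext this.1 this.2
          rw [ha]
          exact mul_lt_mul_of_pos_left (lt_of_le_of_ne (le_gaussNorm v W g b) hb)
            (pos_iff_ne_zero.2 hf0)
        · exact mul_lt_mul_of_lt_of_le_of_nonneg_of_pos
            (lt_of_le_of_ne (le_gaussNorm v W f a) ha) (le_gaussNorm v W g b)
            zero_le (pos_iff_ne_zero.2 hg0)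
      · simpa using hpos
    calc gaussNorm v W f * gaussNorm v W g
        = v ((f * g).coeff (a₀ + b₀)) * W (a₀ + b₀) := by rw [hdom, hmain]
      _ ≤ _ := le_gaussNorm v W _ _

/-- The Gauss norm attached to a valuation on the coefficients and a multiplicative weight on the
exponents, as a valuation on the monoid algebra. -/
def gaussValuation [AddCommMonoid S] [UniqueSums S] (v : Valuation A ℝ≥0)
    (w : Multiplicative S →* ℝ≥0) : Valuation (AddMonoidAlgebra A S) ℝ≥0 where
  toFun := gaussNorm v fun s => w (.ofAdd s)
  map_zero' := by simp [gaussNorm]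
  map_one' := by simp [one_def, gaussNorm_single]
  map_mul' := gaussNorm_mul v w
  map_add_le_max' := gaussNorm_add_le_max v _

lemma gaussValuation_apply [AddCommMonoid S] [UniqueSums S] (v : Valuation A ℝ≥0)
    (w : Multiplicative S →* ℝ≥0) (f : AddMonoidAlgebra A S) :
    gaussValuation v w f = gaussNorm v (fun s => w (.ofAdd s)) f := rfl

end AddMonoidAlgebra

/-! ### Points of the analytification as valuations -/

namespace Toric

namespace AffineAn

variable {k A B : Type*} [NormedField k] [CommRing A] [Algebra k A] [CommRing B] [Algebra k B]

@[ext]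
lemma ext {x y : AffineAn k A} (h : ∀ f, x.val f = y.val f) : x = y :=
  Subtype.ext (DFunLike.ext _ _ h)

lemma continuous_val (f : A) : Continuous fun x : AffineAn k A => x.val f :=
  (continuous_apply f).comp continuous_induced_dom

lemma continuous_iff {X : Type*} [TopologicalSpace X] {φ : X → AffineAn k A} :
    Continuous φ ↔ ∀ f, Continuous fun a => (φ a).val f :=
  continuous_induced_rng.trans continuous_pi_iff

instance : T2Space (AffineAn k A) :=
  T2Space.of_injective_continuous (f := (val : AffineAn k A → A → ℝ))
    (fun _ _ h => ext (congrFun h)) continuous_induced_dom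

/-- A multiplicative seminorm extending an ultrametric absolute value is ultrametric: the binomial
theorem gives `|f + g| ^ n ≤ (n + 1) max(|f|, |g|) ^ n` for all `n`. -/
lemma val_add_le_max [IsUltrametricDist k] (x : AffineAn k A) (f g : A) :
    x.val (f + g) ≤ max (x.val f) (x.val g) := by
  have hnat : ∀ n : ℕ, x.1 (n : A) ≤ 1 := fun n => by
    have h := x.2 (n : k)
    rw [map_natCast] at h
    rw [h]
    exact IsUltrametricDist.norm_natCast_le_one k n
  change x.1 (f + g) ≤ max (x.1 f) (x.1 g)
  set c := max (x.1 f) (x.1 g) with hc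
  have hf0 : 0 ≤ x.1 f := apply_nonneg x.1 f
  have hg0 : 0 ≤ x.1 g := apply_nonneg x.1 g
  have hc0 : 0 ≤ c := hf0.trans (le_max_left _ _)
  have hsum : ∀ (t : Finset ℕ) (F : ℕ → A), x.1 (∑ i ∈ t, F i) ≤ ∑ i ∈ t, x.1 (F i) :=
    fun t F => Finset.le_sum_of_subadditive x.1 (map_zero _).le (map_add_le_add x.1) t F
  have hpow : ∀ n : ℕ, x.1 (f + g) ^ n ≤ (n + 1) * c ^ n := fun n => by
    rw [← map_pow, add_pow]
    refine (hsum _ _).trans ?_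
    calc ∑ i ∈ Finset.range (n + 1), x.1 (f ^ i * g ^ (n - i) * (n.choose i : A))
        ≤ ∑ i ∈ Finset.range (n + 1), c ^ n := by
          refine Finset.sum_le_sum fun i hi => ?_
          have hin : i + (n - i) = n := by
            have := Finset.mem_range.1 hi
            omega
          rw [map_mul, map_mul, map_pow, map_pow]
          calc x.1 f ^ i * x.1 g ^ (n - i) * x.1 (n.choose i : A)
              ≤ c ^ i * c ^ (n - i) * 1 := by
                gcongr
                · exact le_max_left _ _
                · exact le_max_right _ _
                · exact hnat _
            _ = c ^ n := by rw [mul_one, ← pow_add, hin]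
      _ = (n + 1) * c ^ n := by simp
  by_contra! hlt
  set y := x.1 (f + g)
  have hy : 0 < y := hc0.trans_lt hlt
  have hr : c / y < 1 := (div_lt_one hy).2 hlt
  have hr0 : 0 ≤ c / y := div_nonneg hc0 hy.le
  have hlim : Filter.Tendsto (fun n : ℕ => (n : ℝ) * (c / y) ^ n + (c / y) ^ n) Filter.atTop
      (nhds (0 + 0)) :=
    (tendsto_self_mul_const_pow_of_lt_one hr0 hr).add (tendsto_pow_atTop_nhds_zero_of_lt_one hr0 hr)
  -- If `c < y`, then `(n + 1) (c / y) ^ n` tends to `0` but is bounded below by `1`.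
  have hge : ∀ n : ℕ, 1 ≤ (n : ℝ) * (c / y) ^ n + (c / y) ^ n := fun n => by
    have h := hpow n
    rw [div_pow, ← add_one_mul, ← mul_div_assoc, le_div_iff₀ (pow_pos hy n), one_mul]
    exact h
  have := ge_of_tendsto' hlim hge
  norm_num at this

/-- A point of the analytification as a valuation with values in `ℝ≥0`. -/
def valuation [IsUltrametricDist k] (x : AffineAn k A) : Valuation A ℝ≥0 where
  toFun f := ⟨x.val f, apply_nonneg x.1 f⟩
  map_zero' := NNReal.eq (map_zero x.1)
  map_one' := NNReal.eq (map_one x.1)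
  map_mul' f g := NNReal.eq (map_mul x.1 f g)
  map_add_le_max' f g := 
    NNReal.coe_le_coe.1 ((val_add_le_max x f g).trans_eq
      (NNReal.coe_max ⟨x.val f, apply_nonneg x.1 f⟩ ⟨x.val g, apply_nonneg x.1 g⟩).symm)

lemma valuation_algebraMap [IsUltrametricDist k] (x : AffineAn k A) (a : k) :
    x.valuation (algebraMap k A a) = ‖a‖₊ := NNReal.eq (x.2 a)

/-- The point of the analytification given by a valuation that restricts to the norm of `k`. -/
def ofValuation (v : Valuation A ℝ≥0) (hv : ∀ a : k, v (algebraMap k A a) = ‖a‖₊) :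
    AffineAn k A :=
  ⟨{ toFun := fun f => v f
     map_zero' := by simp
     add_le' := fun f g => by
       have h := (v.map_add f g).trans (max_le_add_of_nonneg zero_le zero_le)
       exact_mod_cast h
     neg' := fun f => by rw [v.map_neg]
     map_one' := by simp
     map_mul' := fun f g => by simp },
   fun a => congrArg NNReal.toReal (hv a)⟩

lemma continuous_valuation [IsUltrametricDist k] (f : A) :
    Continuous fun x : AffineAn k A => x.valuation f :=
  Continuous.subtype_mk (continuous_val f) _

end AffineAn

/-- The norm of `k` as a valuation. -/
def normValuation (k : Type*) [NormedField k] [IsUltrametricDist k] : Valuation k ℝ≥0 where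
  toFun a := ‖a‖₊
  map_zero' := by simp
  map_one' := by simp
  map_mul' := by simp
  map_add_le_max' := IsUltrametricDist.nnnorm_add_le_max

/-! ### The logarithm `[0, ∞) ≃ ℝ ∪ {∞}` -/

/-- The map `r ↦ exp (-r)` from `ℝ ∪ {∞}` to `[0, ∞)`, with `exp (-∞) = 0`. -/
def expNeg : WithTop ℝ → ℝ≥0
  | ⊤ => 0
  | (r : ℝ) => ⟨Real.exp (-r), (Real.exp_pos _).le⟩

@[simp] lemma expNeg_top : expNeg ⊤ = 0 := rfl

@[simp] lemma coe_expNeg_coe (r : ℝ) : (expNeg (r : WithTop ℝ) : ℝ) = Real.exp (-r) := rfl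

lemma expNeg_coe_pos (r : ℝ) : 0 < expNeg (r : WithTop ℝ) := Real.exp_pos (-r)

lemma expNeg_zero : expNeg 0 = 1 := NNReal.eq ((coe_expNeg_coe 0).trans (by simp))

lemma expNeg_add (a b : WithTop ℝ) : expNeg (a + b) = expNeg a * expNeg b := by
  induction a using WithTop.recTopCoe with
  | top => simp
  | coe a =>
    induction b using WithTop.recTopCoe with
    | top => simp
    | coe b =>
      refine NNReal.eq ?_
      rw [← WithTop.coe_add, NNReal.coe_mul]
      simp only [coe_expNeg_coe]
      rw [neg_add, Real.exp_add]

lemma expNeg_negLog (r : ℝ≥0) : expNeg (negLog r) = r := by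
  by_cases h : r = 0
  · simp [h, negLog]
  · have h' : (r : ℝ) ≠ 0 := by exact_mod_cast h
    refine NNReal.eq ?_
    rw [negLog, if_neg h', coe_expNeg_coe, neg_neg, Real.exp_log]
    exact lt_of_le_of_ne r.2 h'.symm

lemma expNeg_strictAnti : StrictAnti expNeg := by
  intro a b hab
  induction a using WithTop.recTopCoe with
  | top => exact absurd hab not_top_lt
  | coe a =>
    induction b using WithTop.recTopCoe with
    | top => exact expNeg_coe_pos a
    | coe b =>
      rw [← NNReal.coe_lt_coe, coe_expNeg_coe, coe_expNeg_coe]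
      exact Real.exp_lt_exp.2 (neg_lt_neg (WithTop.coe_lt_coe.1 hab))

lemma negLog_expNeg (a : WithTop ℝ) : negLog (expNeg a) = a :=
  expNeg_strictAnti.injective (expNeg_negLog (expNeg a))

/-- The order-reversing bijection between `ℝ ∪ {∞}` and `[0, ∞)`. -/
def expNegOrderIso : WithTop ℝ ≃o ℝ≥0ᵒᵈ :=
  StrictMono.orderIsoOfRightInverse (fun a => OrderDual.toDual (expNeg a))
    (fun _ _ h => expNeg_strictAnti h) (fun r => negLog (OrderDual.ofDual r : ℝ≥0))
    (fun r => congrArg OrderDual.toDual (expNeg_negLog (OrderDual.ofDual r)))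

lemma continuous_expNeg : Continuous expNeg :=
  continuous_ofDual.comp expNegOrderIso.continuous

lemma continuous_negLog : Continuous fun r : ℝ≥0 => negLog r :=
  expNegOrderIso.symm.continuous.comp continuous_toDual

end Toric

/-! ### Gauss points of an affine chart -/

namespace Toric

open AddMonoidAlgebra

variable {k : Type*} [NormedField k] {M : Type*} [AddCommGroup M]
  {σ τ : PointedCone ℝ (NReal M)}

instance [Module.Free ℤ M] [Module.Finite ℤ M] : UniqueSums (dualMonoid σ) := by
  let b := Module.finBasis ℤ M
  let φ : dualMonoid σ →+ (Fin (Module.finrank ℤ M) → ℤ) :=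
    (b.equivFun : M →+ _).comp (dualMonoid σ).subtype
  exact UniqueSums.of_injective_addHom (G := Fin (Module.finrank ℤ M) → ℤ) (φ : AddHom _ _)
    (b.equivFun.injective.comp Subtype.val_injective) inferInstance

namespace NRCone

/-- A point `u` of `N_ℝ(σ)` as a homomorphism to the additive monoid `ℝ ∪ {∞}`. -/
def toHom (u : NRCone σ) : dualMonoid σ →+ WithTop ℝ := u

lemma continuous_toHom (s : dualMonoid σ) : Continuous fun u : NRCone σ => u.toHom s :=
  (continuous_apply s).comp continuous_induced_dom

lemma continuous_iff {X : Type*} [TopologicalSpace X] {φ : X → NRCone σ} :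
    Continuous φ ↔ ∀ s, Continuous fun a => (φ a).toHom s :=
  continuous_induced_rng.trans continuous_pi_iff

@[ext]
lemma ext {u v : NRCone σ} (h : ∀ s, u.toHom s = v.toHom s) : u = v := AddMonoidHom.ext h

/-- The multiplicative weight `s ↦ exp (-u(s))` on `S_σ` given by a point `u` of `N_ℝ(σ)`. -/
def weight (u : NRCone σ) : Multiplicative (dualMonoid σ) →* ℝ≥0 where
  toFun s := expNeg (u.toHom s.toAdd)
  map_one' := by simp [expNeg_zero]
  map_mul' s t := by simp [expNeg_add]

end NRCone

@[simp]
lemma toHom_tropCone (x : UAn k σ) (s : dualMonoid σ) :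
    (tropCone x).toHom s = negLog (x.val (chi k s)) := rfl

lemma weight_tropCone [IsUltrametricDist k] (x : UAn k σ) (s : dualMonoid σ) :
    (tropCone x).weight (.ofAdd s) = x.valuation (chi k s) :=
  expNeg_negLog (x.valuation (chi k s))

lemma continuous_tropCone [IsUltrametricDist k] :
    Continuous (tropCone : UAn k σ → NRCone σ) :=
  NRCone.continuous_iff.2 fun s =>
    continuous_negLog.comp (AffineAn.continuous_valuation (chi k s))

lemma coeff_coordIncl (h : τ ≤ σ) (f : CoordRing k σ) (s : dualMonoid σ) :
    (coordIncl k h f).coeff (AddSubmonoid.inclusion (dualMonoid_anti h) s) = f.coeff s :=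
  Finsupp.mapDomain_apply (AddSubmonoid.inclusion_injective (dualMonoid_anti h)) _ _

lemma coeff_coordIncl_of_notMem (h : τ ≤ σ) (f : CoordRing k σ) {s : dualMonoid τ}
    (hs : s ∉ Set.range (AddSubmonoid.inclusion (dualMonoid_anti h))) :
    (coordIncl k h f).coeff s = 0 :=
  Finsupp.mapDomain_of_notMem_range _ _ hs

variable [IsUltrametricDist k] [Module.Free ℤ M] [Module.Finite ℤ M]

variable (k) in
/-- The Gauss point of `U_σ^an` attached to `u`, the seminorm
`∑ aₛ χˢ ↦ maxₛ |aₛ| exp (-u(s))`. -/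
def gaussPoint (u : NRCone σ) : UAn k σ :=
  AffineAn.ofValuation (gaussValuation (normValuation k) u.weight) fun a => by
    have h : algebraMap k (CoordRing k σ) a = single 0 a := by simp
    rw [h, gaussValuation_apply, gaussNorm_single, ofAdd_zero, map_one, mul_one]
    rfl

lemma val_gaussPoint (u : NRCone σ) (f : CoordRing k σ) : (gaussPoint k u).val f =
    gaussNorm (normValuation k) (fun s => u.weight (.ofAdd s)) f := rfl

lemma val_gaussPoint_chi (u : NRCone σ) (s : dualMonoid σ) :
    (gaussPoint k u).val (chi k s) = expNeg (u.toHom s) := by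
  rw [val_gaussPoint, chi, gaussNorm_single, map_one, one_mul]
  rfl

lemma isGreatest_gaussPoint_tropCone (x : UAn k σ) (f : CoordRing k σ) :
    IsGreatest (Set.range fun s : dualMonoid σ => ‖f.coeff s‖ * x.val (chi k s))
      ((gaussPoint k (tropCone x)).val f) := by
  have h := isGreatest_gaussNorm (normValuation k)
    (fun s => (tropCone x).weight (.ofAdd s)) f
  simp only [weight_tropCone] at h
  rw [val_gaussPoint]
  simp only [weight_tropCone]
  obtain ⟨⟨s, hs⟩, hle⟩ := h
  refine ⟨⟨s, congrArg NNReal.toReal hs⟩, ?_⟩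
  rintro _ ⟨s, rfl⟩
  exact NNReal.coe_le_coe.2 (hle ⟨s, rfl⟩)

@[simp]
lemma tropCone_gaussPoint (u : NRCone σ) : tropCone (gaussPoint k u) = u := by
  ext s
  rw [toHom_tropCone, val_gaussPoint_chi, negLog_expNeg]

lemma continuous_gaussPoint : Continuous (gaussPoint k : NRCone σ → UAn k σ) := by
  refine AffineAn.continuous_iff.2 fun f => NNReal.continuous_coe.comp ?_
  refine Continuous.finset_sup_apply fun s _ => continuous_const.mul ?_
  exact continuous_expNeg.comp (NRCone.continuous_toHom s)

lemma incl_gaussPoint (h : τ ≤ σ) (u : NRCone τ) :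
    UAn.incl h (gaussPoint k u) = gaussPoint k (NRCone.incl h u) := by
  refine AffineAn.ext fun f => ?_
  change (gaussPoint k u).val (coordIncl k h f) = _
  rw [val_gaussPoint, val_gaussPoint, NNReal.coe_inj]
  refine le_antisymm (gaussNorm_le_iff.2 fun s => ?_) (gaussNorm_le_iff.2 fun s => ?_)
  · by_cases hs : s ∈ Set.range (AddSubmonoid.inclusion (dualMonoid_anti h))
    · obtain ⟨s, rfl⟩ := hs
      rw [coeff_coordIncl]
      exact le_gaussNorm (normValuation k) (fun s => (NRCone.incl h u).weight (.ofAdd s)) f s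
    · rw [coeff_coordIncl_of_notMem h f hs]
      simp
  · rw [← coeff_coordIncl h]
    exact le_gaussNorm (normValuation k) (fun s => u.weight (.ofAdd s)) (coordIncl k h f)
      (AddSubmonoid.inclusion (dualMonoid_anti h) s)

end Toric

/-! ### The flow of a valuation along the torus -/

namespace AddMonoidAlgebra

variable {k S S' ι : Type*} [CommRing k] [AddCommMonoid S] [AddCommMonoid S'] [Fintype ι]

/-- The exponent vector `d + (N, …, N)`. Negative entries are truncated to `0`. -/
def shiftedExponent (N : ℕ) (d : ι → ℤ) : ι →₀ ℕ :=
  Finsupp.equivFunOnFinite.symm fun i => (d i + N).toNat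

lemma shiftedExponent_apply (N : ℕ) (d : ι → ℤ) (i : ι) :
    shiftedExponent N d i = (d i + N).toNat := rfl

lemma shiftedExponent_add {N N' : ℕ} {d d' : ι → ℤ} (h : ∀ i, 0 ≤ d i + N)
    (h' : ∀ i, 0 ≤ d' i + N') :
    shiftedExponent (N + N') (d + d') = shiftedExponent N d + shiftedExponent N' d' := by
  ext i
  have := h i
  have := h' i
  simp only [Finsupp.add_apply, shiftedExponent_apply, Pi.add_apply]
  push_cast
  omega

lemma shiftedExponent_inj {N : ℕ} {d d' : ι → ℤ} (h : ∀ i, 0 ≤ d i + N)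
    (h' : ∀ i, 0 ≤ d' i + N) : shiftedExponent N d = shiftedExponent N d' ↔ d = d' := by
  refine ⟨fun H => funext fun i => ?_, fun H => H ▸ rfl⟩
  have h1 := h i
  have h2 := h' i
  have h3 := DFunLike.congr_fun H i
  simp only [shiftedExponent_apply] at h3
  omega

/-- The polynomial `∑ₛ aₛ χˢ X ^ (e(s) + N)` with coefficients in `k[S]` attached to
`f = ∑ₛ aₛ χˢ`. For `N` large it is, up to the factor `X ^ N`, the image of `f` under the coaction
of the torus. -/
def coaction (e : S →+ (ι → ℤ)) (N : ℕ) :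
    AddMonoidAlgebra k S →+ MvPolynomial ι (AddMonoidAlgebra k S) :=
  (Finsupp.liftAddHom fun s => (MvPolynomial.monomial (shiftedExponent N (e s))).toAddMonoidHom.comp
    (singleAddHom s)).comp coeffAddEquiv.toAddMonoidHom

lemma coaction_eq_sum (e : S →+ (ι → ℤ)) (N : ℕ) (f : AddMonoidAlgebra k S) :
    coaction e N f = ∑ s ∈ f.coeff.support,
      MvPolynomial.monomial (shiftedExponent N (e s)) (single s (f.coeff s)) := rfl

lemma coaction_single (e : S →+ (ι → ℤ)) (N : ℕ) (s : S) (a : k) :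
    coaction e N (single s a) =
      MvPolynomial.monomial (shiftedExponent N (e s)) (single s a) :=
  (Finsupp.liftAddHom_apply_single _ _ _)

/-- A bound on the absolute values of the entries of the vectors `e(s)`, for `s` in the support
of `f`. -/
def exponentBound (e : S →+ (ι → ℤ)) (f : AddMonoidAlgebra k S) : ℕ :=
  f.coeff.support.sup fun s => Finset.univ.sup fun i => (e s i).natAbs

lemma nonneg_of_exponentBound_le {e : S →+ (ι → ℤ)} {f : AddMonoidAlgebra k S} {N : ℕ}
    (h : exponentBound e f ≤ N) {s : S} (hs : s ∈ f.coeff.support) (i : ι) : 0 ≤ e s i + N := by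
  have h1 : (e s i).natAbs ≤ exponentBound e f :=
    (Finset.le_sup (f := fun i => (e s i).natAbs) (Finset.mem_univ i)).trans
      (Finset.le_sup (f := fun s => Finset.univ.sup fun i => (e s i).natAbs) hs)
  omega

lemma coaction_mul {e : S →+ (ι → ℤ)} {f g : AddMonoidAlgebra k S} {N N' : ℕ}
    (hf : exponentBound e f ≤ N) (hg : exponentBound e g ≤ N') :
    coaction e (N + N') (f * g) = coaction e N f * coaction e N' g := by
  rw [coaction_eq_sum e N f, coaction_eq_sum e N' g, Finset.sum_mul_sum, mul_def, Finsupp.sum,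
    map_sum]
  refine Finset.sum_congr rfl fun s hs => ?_
  rw [Finsupp.sum, map_sum]
  refine Finset.sum_congr rfl fun t ht => ?_
  rw [coaction_single, MvPolynomial.monomial_mul, single_mul_single, map_add,
    shiftedExponent_add (nonneg_of_exponentBound_le hf hs) (nonneg_of_exponentBound_le hg ht)]

lemma coaction_add_right {e : S →+ (ι → ℤ)} {f : AddMonoidAlgebra k S} {N : ℕ}
    (hf : exponentBound e f ≤ N) (K : ℕ) :
    coaction e (N + K) f = coaction e N f * ∏ i, MvPolynomial.X i ^ K := by
  have hX : (∏ i, MvPolynomial.X i ^ K : MvPolynomial ι (AddMonoidAlgebra k S)) =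
      MvPolynomial.monomial (shiftedExponent K 0) 1 := by
    rw [MvPolynomial.monomial_eq, map_one, one_mul, Finsupp.prod_fintype _ _ (fun _ => pow_zero _)]
    simp [shiftedExponent_apply]
  rw [hX, coaction_eq_sum, coaction_eq_sum, Finset.sum_mul]
  refine Finset.sum_congr rfl fun s hs => ?_
  rw [MvPolynomial.monomial_mul, mul_one,
    ← shiftedExponent_add (nonneg_of_exponentBound_le hf hs) (fun i => by simp), add_zero]

lemma eval_one_coaction (e : S →+ (ι → ℤ)) (N : ℕ) (f : AddMonoidAlgebra k S) :
    MvPolynomial.eval 1 (coaction e N f) = f := by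
  rw [coaction_eq_sum, map_sum]
  simp only [MvPolynomial.eval_monomial, Pi.one_apply, one_pow, Finsupp.prod_fun_one, mul_one]
  exact sum_coeff_single f

lemma map_coaction {e : S →+ (ι → ℤ)} {e' : S' →+ (ι → ℤ)} {φ : S →+ S'}
    (h : e'.comp φ = e) (N : ℕ) (f : AddMonoidAlgebra k S) :
    MvPolynomial.map (mapDomainRingHom k φ) (coaction e N f) =
      coaction e' N (mapDomainRingHom k φ f) := by
  rw [coaction_eq_sum, map_sum]
  conv_rhs => rw [← sum_coeff_single f, Finsupp.sum, map_sum, map_sum]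
  refine Finset.sum_congr rfl fun s _ => ?_
  rw [MvPolynomial.map_monomial]
  simp [coaction_single, ← h]

/-- If `e` is injective, distinct monomials of `f` contribute to distinct monomials of its
coaction. -/
lemma coeff_coaction {e : S →+ (ι → ℤ)} (he : Function.Injective e) {f : AddMonoidAlgebra k S}
    {N : ℕ} (hf : exponentBound e f ≤ N) {s : S} (hs : s ∈ f.coeff.support) :
    (coaction e N f).coeff (shiftedExponent N (e s)) = single s (f.coeff s) := by
  classical
  rw [coaction_eq_sum, MvPolynomial.coeff_sum, Finset.sum_eq_single s]
  · simp
  · intro t ht hts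
    rw [MvPolynomial.coeff_monomial, if_neg]
    rw [shiftedExponent_inj (nonneg_of_exponentBound_le hf ht) (nonneg_of_exponentBound_le hf hs)]
    exact fun h => hts (he h)
  · exact fun h => absurd hs h

end AddMonoidAlgebra

namespace MvPolynomial

open AddMonoidAlgebra

variable {A B ι : Type*} [CommRing A] [CommRing B]

/-- The weight `d ↦ t ^ |d|` on exponent vectors. -/
def radiusWeight (ι : Type*) (t : ℝ≥0) : Multiplicative (ι →₀ ℕ) →* ℝ≥0 where
  toFun d := t ^ d.toAdd.degree
  map_one' := by simp
  map_mul' d d' := by simp [pow_add]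

/-- The translation `X ↦ X + c` of affine space. -/
def translation (c : A) : MvPolynomial ι A →ₐ[A] MvPolynomial ι A :=
  aeval fun i => X i + C c

lemma translation_X (c : A) (i : ι) : translation c (X i : MvPolynomial ι A) = X i + C c :=
  aeval_X _ _

lemma map_translation_one (φ : A →+* B) (P : MvPolynomial ι A) :
    map φ (translation 1 P) = translation 1 (map φ P) := by
  have h : (map φ).comp (translation (ι := ι) (1 : A)).toRingHom =
      (translation (ι := ι) (1 : B)).toRingHom.comp (map φ) := by
    refine ringHom_ext (fun a => ?_) fun i => ?_
    · simp [translation]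
    · simp [translation]
  exact RingHom.congr_fun h P

lemma gaussNorm_map (v : Valuation B ℝ≥0) (φ : A →+* B) (w : (ι →₀ ℕ) → ℝ≥0)
    (P : MvPolynomial ι A) : gaussNorm v w (map φ P) = gaussNorm (v.comap φ) w P := by
  have h : ∀ d, v (AddMonoidAlgebra.coeff (map φ P) d) =
      v.comap φ (AddMonoidAlgebra.coeff P d) :=
    fun d => congrArg v (coeff_map φ P d)
  refine le_antisymm (gaussNorm_le_iff.2 fun d => ?_) (gaussNorm_le_iff.2 fun d => ?_)
  · rw [h]
    exact le_gaussNorm _ w P d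
  · rw [← h]
    exact le_gaussNorm v w _ d

/-- The valuation on `A[X]` given by the maximal point of the polydisc of radius `t` around
`(1, …, 1)`. -/
def polydisc (v : Valuation A ℝ≥0) (t : ℝ≥0) : Valuation (MvPolynomial ι A) ℝ≥0 :=
  (gaussValuation v (radiusWeight ι t)).comap (translation (ι := ι) (1 : A)).toRingHom

lemma polydisc_apply (v : Valuation A ℝ≥0) (t : ℝ≥0) (P : MvPolynomial ι A) :
    polydisc v t P = gaussNorm v (fun d => t ^ d.degree) (translation 1 P) := rfl

lemma gaussNorm_C (v : Valuation A ℝ≥0) (t : ℝ≥0) (a : A) :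
    gaussNorm v (fun d => t ^ d.degree) (C a : MvPolynomial ι A) = v a :=
  (gaussNorm_single v _ _ _).trans (by simp)

lemma gaussNorm_X (v : Valuation A ℝ≥0) (t : ℝ≥0) (i : ι) :
    gaussNorm v (fun d => t ^ d.degree) (X i : MvPolynomial ι A) = t :=
  (gaussNorm_single v _ _ _).trans (by simp)

lemma polydisc_X (v : Valuation A ℝ≥0) {t : ℝ≥0} (ht : t ≤ 1) (i : ι) :
    polydisc v t (X i) = 1 := by
  rw [polydisc_apply, translation_X]
  refine le_antisymm ((gaussNorm_add_le_max _ _ _ _).trans ?_) ?_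
  · rw [gaussNorm_X, gaussNorm_C, map_one]
    exact max_le ht le_rfl
  · have h := le_gaussNorm v (fun d => t ^ d.degree) (X i + C 1 : MvPolynomial ι A) 0
    have h0 : AddMonoidAlgebra.coeff (X i + C 1 : MvPolynomial ι A) 0 = 1 := by
      change MvPolynomial.coeff 0 (X i + C 1 : MvPolynomial ι A) = 1
      simp
    rw [h0] at h
    simpa using h

lemma polydisc_mono (v : Valuation A ℝ≥0) {t t' : ℝ≥0} (h : t ≤ t') (P : MvPolynomial ι A) :
    polydisc v t P ≤ polydisc v t' P :=
  gaussNorm_mono v (fun d : ι →₀ ℕ => pow_le_pow_left' h d.degree) _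

/-- For radius `0` the polydisc is the point `(1, …, 1)`: since `0 ^ 0 = 1`, only the constant
coefficient of the translated polynomial counts. -/
lemma polydisc_zero (v : Valuation A ℝ≥0) (P : MvPolynomial ι A) :
    polydisc v 0 P = v (eval 1 P) := by
  have hcoeff : AddMonoidAlgebra.coeff (translation 1 P) 0 = eval 1 P := by
    have h : (constantCoeff).comp (translation (ι := ι) (1 : A)).toRingHom =
        eval 1 := by
      refine ringHom_ext (fun a => ?_) fun i => ?_
      · simp [translation]
      · simp [translation]
    exact RingHom.congr_fun h P
  rw [polydisc_apply, ← hcoeff]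
  refine le_antisymm (gaussNorm_le_iff.2 fun d => ?_) ?_
  · by_cases hd : d = 0
    · simp [hd]
    · have : d.degree ≠ 0 := fun h => hd ((Finsupp.degree_eq_zero_iff d).1 h)
      simp [this]
  · simpa using le_gaussNorm v (fun d => 0 ^ d.degree) (translation 1 P) 0

/-- Translations by integral elements do not increase the Gauss norm of radius `1`. -/
lemma gaussNorm_translation_le (v : Valuation A ℝ≥0) {c : A} (hc : v c ≤ 1) (P : MvPolynomial ι A) :
    gaussNorm v (fun d => 1 ^ d.degree) (translation c P) ≤
      gaussNorm v (fun d => 1 ^ d.degree) P := by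
  set g : Valuation (MvPolynomial ι A) ℝ≥0 := gaussValuation v (radiusWeight ι 1) with hg
  change g (translation c P) ≤ g P
  rw [P.as_sum, map_sum]
  refine g.map_sum_le fun d _ => ?_
  rw [← P.as_sum, monomial_eq, map_mul, Finsupp.prod, map_prod, map_mul, map_prod]
  have h1 : ∀ i, g (translation c (X i)) ≤ 1 := fun i => by
    rw [translation_X]
    refine (g.map_add _ _).trans (max_le (gaussNorm_X v 1 i).le ?_)
    exact (gaussNorm_C v 1 c).trans_le hc
  have h2 : g (translation c (C (P.coeff d))) = v (P.coeff d) := by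
    rw [translation, aeval_C]
    exact gaussNorm_C v 1 _
  rw [h2]
  refine (mul_le_of_le_one_right' (Finset.prod_le_one' fun i _ => ?_)).trans ?_
  · rw [map_pow, map_pow]
    exact pow_le_one' (h1 i) _
  · have h := le_gaussNorm v (fun d => 1 ^ d.degree) P d
    rw [one_pow, mul_one] at h
    exact h

/-- For radius `1` the center of the polydisc does not matter. -/
lemma polydisc_one (v : Valuation A ℝ≥0) (P : MvPolynomial ι A) :
    polydisc v 1 P = gaussNorm v (fun d => 1 ^ d.degree) P := by
  refine le_antisymm (gaussNorm_translation_le v (by simp) P) ?_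
  have h : translation (-1) (translation 1 P) = P := by
    have h : (translation (ι := ι) (-1 : A)).comp (translation 1) = AlgHom.id A _ := by
      refine algHom_ext fun i => ?_
      simp [translation]
    exact AlgHom.congr_fun h P
  calc _ = gaussNorm v (fun d => 1 ^ d.degree) (translation (-1) (translation 1 P)) := by rw [h]
    _ ≤ _ := gaussNorm_translation_le v (by simp) _

lemma polydisc_map (v : Valuation B ℝ≥0) (φ : A →+* B) (t : ℝ≥0) (P : MvPolynomial ι A) :
    polydisc v t (map φ P) = polydisc (v.comap φ) t P := by
  rw [polydisc_apply, ← map_translation_one, gaussNorm_map, polydisc_apply]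

end MvPolynomial

namespace AddMonoidAlgebra

open MvPolynomial

variable {k S S' ι : Type*} [CommRing k] [AddCommMonoid S] [AddCommMonoid S'] [Fintype ι]

/-- The exponent shift `N` does not matter once it is large enough. -/
lemma polydisc_coaction_eq {e : S →+ (ι → ℤ)} (v : Valuation (AddMonoidAlgebra k S) ℝ≥0)
    {t : ℝ≥0} (ht : t ≤ 1) {f : AddMonoidAlgebra k S} {N : ℕ} (h : exponentBound e f ≤ N) :
    polydisc v t (coaction e N f) = polydisc v t (coaction e (exponentBound e f) f) := by
  obtain ⟨K, rfl⟩ := Nat.exists_eq_add_of_le h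
  rw [coaction_add_right le_rfl, map_mul, map_prod]
  simp [polydisc_X v ht]

/-- The valuation obtained by letting the polydisc of radius `t ≤ 1` around the identity of the
torus act on `v`. It is read off from the coaction, which becomes polynomial after multiplication
by a power of the coordinates; the power does not matter because the coordinates have norm `1`. -/
def flow (e : S →+ (ι → ℤ)) (v : Valuation (AddMonoidAlgebra k S) ℝ≥0) (t : ℝ≥0) (ht : t ≤ 1) :
    Valuation (AddMonoidAlgebra k S) ℝ≥0 where
  toFun f := polydisc v t (coaction e (exponentBound e f) f)
  map_zero' := by simp
  map_one' := by
    rw [← polydisc_coaction_eq v ht le_rfl, one_def, coaction_single, monomial_eq, ← one_def,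
      map_one, one_mul, Finsupp.prod, map_prod]
    simp [polydisc_X v ht]
  map_mul' f g := by
    have h := coaction_mul (e := e) (f := f) (g := g) (le_add_right (le_refl (exponentBound e f)))
      (le_refl (exponentBound e g)) (N := exponentBound e f + exponentBound e (f * g))
    rw [← polydisc_coaction_eq v ht (by omega : exponentBound e (f * g) ≤
      exponentBound e f + exponentBound e (f * g) + exponentBound e g), h, map_mul,
      polydisc_coaction_eq v ht (by omega)]
  map_add_le_max' f g := by
    set N := exponentBound e (f + g) + exponentBound e f + exponentBound e g
    rw [← polydisc_coaction_eq v ht (by omega : exponentBound e (f + g) ≤ N),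
      ← polydisc_coaction_eq v ht (by omega : exponentBound e f ≤ N),
      ← polydisc_coaction_eq v ht (by omega : exponentBound e g ≤ N), map_add]
    exact Valuation.map_add _ _ _

variable {e : S →+ (ι → ℤ)} {v : Valuation (AddMonoidAlgebra k S) ℝ≥0} {t : ℝ≥0}

lemma flow_apply (ht : t ≤ 1) {f : AddMonoidAlgebra k S} {N : ℕ} (h : exponentBound e f ≤ N) :
    flow e v t ht f = polydisc v t (coaction e N f) :=
  (polydisc_coaction_eq v ht h).symm

lemma flow_single_zero (ht : t ≤ 1) (a : k) : flow e v t ht (single 0 a) = v (single 0 a) := by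
  rw [flow_apply ht le_rfl, coaction_single, monomial_eq, map_mul, Finsupp.prod, map_prod]
  have h : polydisc v t (C (single 0 a) : MvPolynomial ι _) = v (single 0 a) := by
    rw [polydisc_apply, translation, aeval_C]
    exact gaussNorm_C v t _
  simp [h, polydisc_X v ht]

lemma flow_mono {t' : ℝ≥0} (ht : t ≤ 1) (ht' : t' ≤ 1) (h : t ≤ t') (f : AddMonoidAlgebra k S) :
    flow e v t ht f ≤ flow e v t' ht' f :=
  polydisc_mono v h _

lemma flow_zero (f : AddMonoidAlgebra k S) : flow e v 0 zero_le_one f = v f := by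
  rw [flow_apply zero_le_one le_rfl, polydisc_zero, eval_one_coaction]

/-- At time `1` the flow reaches the maximum of the values of the monomials of `f`. -/
lemma flow_one (he : Function.Injective e) (f : AddMonoidAlgebra k S) :
    flow e v 1 le_rfl f = f.coeff.support.sup fun s => v (single s (f.coeff s)) := by
  rw [flow_apply le_rfl le_rfl, polydisc_one]
  refine le_antisymm ?_ (Finset.sup_le fun s hs => ?_)
  · rw [coaction_eq_sum]
    refine gaussNorm_sum_le _ _ _ _ fun s hs => ?_
    rw [← single_eq_monomial, gaussNorm_single, one_pow, mul_one]
    exact Finset.le_sup (f := fun s => v (single s (f.coeff s))) hs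
  · have h := le_gaussNorm v (fun d => 1 ^ d.degree) (coaction e (exponentBound e f) f)
      (shiftedExponent (exponentBound e f) (e s))
    have hc : AddMonoidAlgebra.coeff (coaction e (exponentBound e f) f)
        (shiftedExponent (exponentBound e f) (e s)) = _ := coeff_coaction he le_rfl hs
    rw [hc, one_pow, mul_one] at h
    exact h

lemma flow_comap {e' : S' →+ (ι → ℤ)} {φ : S →+ S'} (h : e'.comp φ = e)
    (v : Valuation (AddMonoidAlgebra k S') ℝ≥0) (ht : t ≤ 1) (f : AddMonoidAlgebra k S) :
    flow e (v.comap (mapDomainRingHom k φ)) t ht f = flow e' v t ht (mapDomainRingHom k φ f) := by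
  set N := exponentBound e f + exponentBound e' (mapDomainRingHom k φ f)
  rw [flow_apply ht (by omega : _ ≤ N), flow_apply ht (by omega : _ ≤ N), ← map_coaction h,
    polydisc_map]

end AddMonoidAlgebra

/-! ### The deformation of an affine chart onto its Gauss points -/

namespace Toric

open AddMonoidAlgebra

variable {k : Type*} [NormedField k] {M : Type*} [AddCommGroup M]
  {σ τ : PointedCone ℝ (NReal M)}

section Flow

variable [IsUltrametricDist k] [Module.Free ℤ M] [Module.Finite ℤ M]

/-- The coordinates of the elements of `S_σ` with respect to a fixed basis of `M`. -/
def charCoords (σ : PointedCone ℝ (NReal M)) :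
    dualMonoid σ →+ (Fin (Module.finrank ℤ M) → ℤ) :=
  ((Module.finBasis ℤ M).equivFun : M →+ _).comp (dualMonoid σ).subtype

lemma charCoords_injective : Function.Injective (charCoords σ) :=
  (Module.finBasis ℤ M).equivFun.injective.comp Subtype.val_injective

lemma charCoords_comp_inclusion (h : τ ≤ σ) :
    (charCoords τ).comp (AddSubmonoid.inclusion (dualMonoid_anti h)) = charCoords σ := rfl

lemma toNNReal_le_one (t : unitInterval) : unitInterval.toNNReal t ≤ 1 := t.2.2

/-- The action on `x` of the polydisc of radius `t` around the identity of the torus. -/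
def torusFlow (t : unitInterval) (x : UAn k σ) : UAn k σ :=
  AffineAn.ofValuation
    (flow (charCoords σ) x.valuation (unitInterval.toNNReal t) (toNNReal_le_one t)) fun a => by
    have h : algebraMap k (CoordRing k σ) a = single 0 a := by simp
    rw [h, flow_single_zero, ← h, AffineAn.valuation_algebraMap]

lemma torusFlow_zero (x : UAn k σ) : torusFlow 0 x = x :=
  AffineAn.ext fun f => congrArg NNReal.toReal
    (flow_zero (e := charCoords σ) (v := x.valuation) f)

lemma torusFlow_one (x : UAn k σ) : torusFlow 1 x = gaussPoint k (tropCone x) := by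
  refine AffineAn.ext fun f => congrArg NNReal.toReal
    ((flow_one (v := x.valuation) charCoords_injective f).trans ?_)
  refine Finset.sup_congr rfl fun s _ => ?_
  have h : (single s (f.coeff s) : CoordRing k σ) =
      algebraMap k (CoordRing k σ) (f.coeff s) * chi k s := by
    simp [chi, single_mul_single]
  rw [h, map_mul, AffineAn.valuation_algebraMap]
  dsimp only
  rw [weight_tropCone]
  rfl

/-- Gauss points do not move: the values along the flow are squeezed between those at the times
`0` and `1`, which agree. -/
lemma torusFlow_gaussPoint (t : unitInterval) (u : NRCone σ) :
    torusFlow t (gaussPoint k u) = gaussPoint k u := by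
  refine AffineAn.ext fun f => le_antisymm ?_ ?_
  · refine (NNReal.coe_le_coe.2
      (flow_mono (toNNReal_le_one t) le_rfl (toNNReal_le_one t) f)).trans_eq ?_
    exact congrArg (fun y => AffineAn.val y f)
      ((torusFlow_one (gaussPoint k u)).trans (congrArg _ (tropCone_gaussPoint u)))
  · refine Eq.trans_le ?_
      (NNReal.coe_le_coe.2 (flow_mono zero_le_one (toNNReal_le_one t) zero_le f))
    exact (congrArg (fun y => AffineAn.val y f) (torusFlow_zero (gaussPoint k u))).symm

/-- For a fixed `f` the flow is a maximum over the finitely many monomials of the translated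
coaction of `f`, which depends neither on the time nor on the point. -/
lemma continuous_torusFlow : Continuous fun q : unitInterval × UAn k σ => torusFlow q.1 q.2 := by
  refine AffineAn.continuous_iff.2 fun f => NNReal.continuous_coe.comp ?_
  refine Continuous.finset_sup_apply fun d _ => ?_
  refine ((AffineAn.continuous_valuation _).comp continuous_snd).mul ?_
  exact (unitInterval.toNNReal_continuous.comp continuous_fst).pow _

lemma torusFlow_incl (h : τ ≤ σ) (t : unitInterval) (z : UAn k τ) :
    torusFlow t (UAn.incl h z) = UAn.incl h (torusFlow t z) :=
  AffineAn.ext fun f => congrArg NNReal.toReal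
    (flow_comap (charCoords_comp_inclusion h) z.valuation (toNNReal_le_one t) f)

end Flow

/-! ### Faces and localization -/

/-- A cone of the fan that is contained in another one is a face of it. -/
lemma Fan.isFace_of_le {Δ : Fan M} {σ τ : PointedCone ℝ (NReal M)} (hσ : σ ∈ Δ.cones)
    (hτ : τ ∈ Δ.cones) (h : τ ≤ σ) : IsFace τ σ := by
  simpa [inf_eq_right.2 h] using (Δ.inter_face σ hσ τ hτ).1

/-- If `τ = σ ∩ m^⊥`, then `S_τ = S_σ + ℕ (-m)`. On each of the finitely many integral generators
of `σ` either `m` vanishes, so that the generator lies in `τ`, or `m` is at least `1`, so that a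
large multiple of `m` compensates a negative value. -/
lemma exists_add_nsmul_mem_dualMonoid (hσ : IsRationalPolyhedral σ) {m : M}
    (hm : m ∈ dualMonoid σ) (hτ : ∀ u : NReal M, u ∈ τ ↔ u ∈ σ ∧ u m = 0) {s : M}
    (hs : s ∈ dualMonoid τ) : ∃ N : ℕ, s + N • m ∈ dualMonoid σ := by
  obtain ⟨G, rfl⟩ := hσ
  refine ⟨G.sup fun g => (g s).natAbs, ?_⟩
  set N := G.sup fun g => (g s).natAbs with hN
  intro u hu
  have key : ∀ g ∈ G, 0 ≤ g.toReal (s + N • m) := by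
    intro g hg
    have hgσ : g.toReal ∈ PointedCone.hull ℝ (Cochar.toReal '' (G : Set (Cochar M))) :=
      Submodule.subset_span ⟨g, hg, rfl⟩
    have hgm : 0 ≤ g m := by
      have := hm _ hgσ
      simpa [Cochar.toReal] using this
    have hgN : (g s).natAbs ≤ N := Finset.le_sup (f := fun g : Cochar M => (g s).natAbs) hg
    have hint : 0 ≤ g s + N * g m := by
      rcases hgm.eq_or_lt with h0 | h0
      · have hgs := hs _ ((hτ _).2 ⟨hgσ, by simp [Cochar.toReal, ← h0]⟩)
        have : 0 ≤ g s := by simpa [Cochar.toReal] using hgs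
        simpa [← h0] using this
      · have : (N : ℤ) * 1 ≤ N * g m := by gcongr; omega
        omega
    have : (0 : ℝ) ≤ ((g s + N * g m : ℤ) : ℝ) := by exact_mod_cast hint
    simpa [Cochar.toReal] using this
  induction hu using Submodule.span_induction with
  | mem u hu =>
    obtain ⟨g, hg, rfl⟩ := hu
    exact key g hg
  | zero => simp
  | add u v _ _ hu hv => exact add_nonneg hu hv
  | smul c u _ hu => exact mul_nonneg c.2 hu

/-- If `τ` is a face of `σ`, then `k[S_τ]` is the localization of `k[S_σ]` at a character, so that
a point of `U_τ^an` is determined by its image in `U_σ^an`. -/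
lemma incl_injective_of_isFace (hσ : IsRationalPolyhedral σ) (h : τ ≤ σ) (hface : IsFace τ σ) :
    Function.Injective (UAn.incl h : UAn k τ → UAn k σ) := by
  obtain ⟨m, hm, hτ⟩ := hface
  intro z z' hzz
  have hval : ∀ f, z.val (coordIncl k h f) = z'.val (coordIncl k h f) := fun f =>
    congrArg (fun y => AffineAn.val y f) hzz
  have hchi : ∀ s : dualMonoid σ, coordIncl k h (chi k s) =
      chi k (AddSubmonoid.inclusion (dualMonoid_anti h) s) := fun s => by
    simp [coordIncl, chi]
  have hmτ : m ∈ dualMonoid τ := dualMonoid_anti h hm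
  have hmneg : -m ∈ dualMonoid τ := fun u hu => by simp [((hτ u).1 hu).2]
  have hadd : ∀ s t : dualMonoid τ, chi k (s + t) = chi k s * chi k t := fun s t => by
    simp [chi, single_mul_single]
  -- A power of `χ^m` clears the denominators of any element of `k[S_τ]`.
  have hclear : ∀ f : CoordRing k τ, ∃ (N : ℕ) (g : CoordRing k σ),
      f * chi k ⟨m, hmτ⟩ ^ N = coordIncl k h g := by
    intro f
    induction f using AddMonoidAlgebra.induction_linear with
    | zero => exact ⟨0, 0, by simp⟩
    | add f f' hf hf' =>
      obtain ⟨N, g, hg⟩ := hf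
      obtain ⟨N', g', hg'⟩ := hf'
      refine ⟨N + N', g * chi k ⟨m, hm⟩ ^ N' + g' * chi k ⟨m, hm⟩ ^ N, ?_⟩
      have hm' : coordIncl k h (chi k ⟨m, hm⟩) = chi k ⟨m, hmτ⟩ := hchi _
      rw [map_add, map_mul, map_mul, map_pow, map_pow, ← hg, ← hg', hm']
      ring
    | single s a =>
      obtain ⟨N, hN⟩ := exists_add_nsmul_mem_dualMonoid hσ hm hτ s.2
      refine ⟨N, single ⟨_, hN⟩ a, ?_⟩
      simp only [chi, coordIncl, single_pow, single_mul_single, one_pow, mul_one,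
        mapDomainAlgHom_apply, mapDomain_single]
      rfl
  refine AffineAn.ext fun f => ?_
  obtain ⟨N, g, hg⟩ := hclear f
  have hm_eq : z.val (chi k ⟨m, hmτ⟩) = z'.val (chi k ⟨m, hmτ⟩) := by
    have := hval (chi k ⟨m, hm⟩)
    rwa [hchi] at this
  have hm_ne : z.1 (chi k ⟨m, hmτ⟩) ≠ 0 := by
    intro h0
    have h1 : z.1 (chi k ⟨m, hmτ⟩ * chi k ⟨-m, hmneg⟩) = 1 := by
      rw [← hadd]
      have : (⟨m, hmτ⟩ + ⟨-m, hmneg⟩ : dualMonoid τ) = 0 := Subtype.ext (add_neg_cancel m)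
      rw [this]
      exact map_one z.1
    rw [map_mul, h0, zero_mul] at h1
    exact zero_ne_one h1
  have hfg := hval g
  rw [← hg] at hfg
  change z.1 _ = z'.1 _ at hfg
  change z.1 _ = z'.1 _ at hm_eq
  rw [map_mul, map_mul, map_pow, map_pow, ← hm_eq] at hfg
  exact mul_right_cancel₀ (pow_ne_zero N hm_ne) hfg

/-! ### Gluing -/

lemma XAn.chart_incl {Δ : Fan M} (σ τ : Δ.cones) (h : τ.1 ≤ σ.1) (z : UAn k τ.1) :
    XAn.chart (Δ := Δ) σ (UAn.incl h z) = XAn.chart τ z :=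
  Quot.sound ⟨τ, h, le_rfl, z, rfl, AffineAn.ext fun f => by
    change z.val f = z.val (coordIncl k le_rfl f)
    congr 1
    exact (AlgHom.congr_fun mapDomainAlgHom_id f).symm⟩

lemma XAn.continuous_chart {Δ : Fan M} (σ : Δ.cones) :
    Continuous (XAn.chart σ : UAn k σ.1 → XAn k Δ) :=
  continuous_quot_mk.comp continuous_sigmaMk

lemma XAn.exists_chart {Δ : Fan M} (x : XAn k Δ) :
    ∃ σ x', XAn.chart (k := k) (Δ := Δ) σ x' = x := by
  obtain ⟨⟨σ, x'⟩, rfl⟩ := Quot.exists_rep x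
  exact ⟨σ, x', rfl⟩

/-- The chart `N_ℝ(σ) → N_ℝ(Δ)`. -/
def NR.chart {Δ : Fan M} (σ : Δ.cones) (u : NRCone σ.1) : NR Δ := Quot.mk _ ⟨σ, u⟩

lemma NR.continuous_chart {Δ : Fan M} (σ : Δ.cones) :
    Continuous (NR.chart σ : NRCone σ.1 → NR Δ) :=
  continuous_quot_mk.comp continuous_sigmaMk

lemma NR.exists_chart {Δ : Fan M} (u : NR Δ) : ∃ σ u', NR.chart (Δ := Δ) σ u' = u := by
  obtain ⟨⟨σ, u'⟩, rfl⟩ := Quot.exists_rep u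
  exact ⟨σ, u', rfl⟩

lemma trop_chart {Δ : Fan M} (σ : Δ.cones) (x : UAn k σ.1) :
    trop (XAn.chart (Δ := Δ) σ x) = NR.chart σ (tropCone x) := rfl

section Global

variable [IsUltrametricDist k] {Δ : Fan M}

lemma continuous_trop : Continuous (trop : XAn k Δ → NR Δ) :=
  continuous_quot_lift _ <| continuous_sigma fun σ =>
    (NR.continuous_chart σ).comp continuous_tropCone

variable [Module.Free ℤ M] [Module.Finite ℤ M]

variable (k) in
/-- The section `N_ℝ(Δ) → X^an` of the tropicalization map, given on charts by the Gauss points. -/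
def gaussSection : NR Δ → XAn k Δ :=
  Quot.map (fun a => ⟨a.1, gaussPoint k a.2⟩) (by
    rintro ⟨σ, x⟩ ⟨τ, y⟩ ⟨ρ, h₁, h₂, w, hx, hy⟩
    refine ⟨ρ, h₁, h₂, gaussPoint k w, ?_, ?_⟩
    · exact (congrArg (gaussPoint k) hx).trans (incl_gaussPoint h₁ w).symm
    · exact (congrArg (gaussPoint k) hy).trans (incl_gaussPoint h₂ w).symm)

lemma gaussSection_chart (σ : Δ.cones) (u : NRCone σ.1) :
    gaussSection k (NR.chart (Δ := Δ) σ u) = XAn.chart σ (gaussPoint k u) := rfl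

lemma continuous_gaussSection : Continuous (gaussSection k : NR Δ → XAn k Δ) :=
  continuous_quot_lift _ <| continuous_sigma fun σ =>
    (XAn.continuous_chart σ).comp continuous_gaussPoint

lemma trop_gaussSection (u : NR Δ) : trop (gaussSection k u) = u := by
  obtain ⟨σ, u, rfl⟩ := NR.exists_chart u
  rw [gaussSection_chart, trop_chart, tropCone_gaussPoint]

/-- The property of a point of a chart to be a Gauss point descends to `X^an`: it passes from
`U_τ^an` to `U_σ^an` because Gauss points are compatible with inclusions, and back because these
inclusions are injective. -/
def IsGaussPoint : XAn k Δ → Prop :=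
  Quot.lift (fun a => gaussPoint k (tropCone a.2) = a.2) (by
    have key : ∀ (σ ρ : Δ.cones) (h : ρ.1 ≤ σ.1) (z : UAn k ρ.1),
        gaussPoint k (tropCone (UAn.incl h z)) = UAn.incl h z ↔ gaussPoint k (tropCone z) = z := by
      intro σ ρ h z
      rw [tropCone_incl, ← incl_gaussPoint]
      exact (incl_injective_of_isFace (Δ.rational _ σ.2) h
        (Δ.isFace_of_le σ.2 ρ.2 h)).eq_iff
    rintro ⟨σ, x⟩ ⟨τ, y⟩ ⟨ρ, h₁, h₂, z, hx, hy⟩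
    dsimp only at hx hy h₁ h₂ ⊢
    rw [hx, hy, key σ ρ h₁, key τ ρ h₂])

lemma isGaussPoint_chart (σ : Δ.cones) (x : UAn k σ.1) :
    IsGaussPoint (XAn.chart (Δ := Δ) σ x) ↔ gaussPoint k (tropCone x) = x := Iff.rfl

lemma isClosed_setOf_isGaussPoint : IsClosed {x : XAn k Δ | IsGaussPoint x} := by
  refine isQuotientMap_quot_mk.isClosed_preimage.1 (isClosed_sigma_iff.2 fun σ => ?_)
  exact isClosed_eq (continuous_gaussPoint.comp continuous_tropCone) continuous_id

lemma isGaussPoint_gaussSection (u : NR Δ) : IsGaussPoint (gaussSection k u) := by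
  obtain ⟨σ, u, rfl⟩ := NR.exists_chart u
  rw [gaussSection_chart, isGaussPoint_chart, tropCone_gaussPoint]

lemma IsGaussPoint.gaussSection_trop {x : XAn k Δ} (hx : IsGaussPoint x) :
    gaussSection k (trop x) = x := by
  obtain ⟨σ, x, rfl⟩ := XAn.exists_chart x
  rw [trop_chart, gaussSection_chart, (isGaussPoint_chart σ x).1 hx]

/-- The section of the tropicalization map as a homeomorphism onto the set of Gauss points. -/
def gaussHomeomorph : NR Δ ≃ₜ {x : XAn k Δ | IsGaussPoint x} where
  toFun u := ⟨gaussSection k u, isGaussPoint_gaussSection u⟩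
  invFun x := trop x.1
  left_inv := trop_gaussSection
  right_inv x := Subtype.ext x.2.gaussSection_trop
  continuous_toFun := continuous_gaussSection.subtype_mk _
  continuous_invFun := continuous_trop.comp continuous_subtype_val

/-- The path in `X^an` traced out by a point of a chart under the flow. -/
def chartPath (σ : Δ.cones) (x : UAn k σ.1) : C(unitInterval, XAn k Δ) where
  toFun t := XAn.chart σ (torusFlow t x)
  continuous_toFun := by
    have h : Continuous fun t : unitInterval => torusFlow t x :=
      Continuous.comp (g := fun q : unitInterval × UAn k σ.1 => torusFlow q.1 q.2)
        (f := fun t => (t, x)) continuous_torusFlow (Continuous.prodMk_left x)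
    exact (XAn.continuous_chart σ).comp h

/-- The flow glued from those of the charts, as a map from `X^an` to the space of paths. -/
def torusPath : XAn k Δ → C(unitInterval, XAn k Δ) :=
  Quot.lift (fun a => chartPath a.1 a.2) (by
    rintro ⟨σ, x⟩ ⟨τ, y⟩ ⟨ρ, h₁, h₂, z, hx, hy⟩
    dsimp only at hx hy h₁ h₂ ⊢
    refine ContinuousMap.ext fun t => ?_
    change XAn.chart σ (torusFlow t x) = XAn.chart τ (torusFlow t y)
    rw [hx, hy, torusFlow_incl, torusFlow_incl, XAn.chart_incl, XAn.chart_incl])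

lemma torusPath_chart (σ : Δ.cones) (x : UAn k σ.1) (t : unitInterval) :
    torusPath (XAn.chart (Δ := Δ) σ x) t = XAn.chart σ (torusFlow t x) := rfl

lemma continuous_torusPath : Continuous (torusPath : XAn k Δ → C(unitInterval, XAn k Δ)) := by
  refine continuous_quot_lift _ <| continuous_sigma fun σ => ?_
  refine ContinuousMap.continuous_of_continuous_uncurry _ ?_
  exact (XAn.continuous_chart σ).comp (continuous_torusFlow.comp continuous_swap)

lemma continuous_torusPath_uncurry :
    Continuous fun q : unitInterval × XAn k Δ => torusPath q.2 q.1 :=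
  ContinuousEval.continuous_eval.comp
    ((continuous_torusPath.comp continuous_snd).prodMk continuous_fst)

variable (k Δ) in
/-- The retraction of `X^an` onto its Gauss points. -/
def gaussRetraction : C(XAn k Δ, XAn k Δ) :=
  ⟨fun x => gaussSection k (trop x), continuous_gaussSection.comp continuous_trop⟩

lemma isStrongDeformationRetraction_gaussRetraction :
    IsStrongDeformationRetraction (gaussRetraction k Δ) {x | IsGaussPoint x} := by
  refine ⟨?_, ⟨{ toFun := fun q => torusPath q.2 q.1
                 continuous_toFun := continuous_torusPath_uncurry
                 map_zero_left := fun x => ?_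
                 map_one_left := fun x => ?_
                 prop' := fun t x hx => ?_ }⟩⟩
  · refine Set.Subset.antisymm ?_ fun x hx => ⟨x, IsGaussPoint.gaussSection_trop hx⟩
    rintro _ ⟨x, rfl⟩
    exact isGaussPoint_gaussSection _
  · obtain ⟨σ, x, rfl⟩ := XAn.exists_chart x
    change torusPath _ 0 = _
    rw [torusPath_chart, torusFlow_zero]
    rfl
  · obtain ⟨σ, x, rfl⟩ := XAn.exists_chart x
    change torusPath _ 1 = _
    rw [torusPath_chart, torusFlow_one]
    rfl
  · obtain ⟨σ, x, rfl⟩ := XAn.exists_chart x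
    change torusPath (XAn.chart σ x) t = XAn.chart σ x
    rw [torusPath_chart, ← (isGaussPoint_chart σ x).1 hx, torusFlow_gaussPoint]

end Global

end Toric

end

theorem lemma4p1 {k : Type*} [NormedField k] [IsUltrametricDist k] [CompleteSpace k]
    {M : Type*} [AddCommGroup M] [Module.Free ℤ M] [Module.Finite ℤ M] (Δ : Toric.Fan M) :
    ∃ (S : Set (Toric.XAn k Δ)) (p : C(Toric.XAn k Δ, Toric.XAn k Δ)) (J : Toric.NR Δ ≃ₜ S),
      IsClosed S ∧
      Toric.IsStrongDeformationRetraction p S ∧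
      (∀ x : Toric.XAn k Δ, (J (Toric.trop x) : Toric.XAn k Δ) = p x) ∧
      (∀ (σ : Δ.cones) (x : Toric.UAn k σ.1), ∃ y : Toric.UAn k σ.1,
        p (Toric.XAn.chart σ x) = Toric.XAn.chart σ y ∧
        ∀ f : Toric.CoordRing k σ.1,
          IsGreatest (Set.range fun s : Toric.dualMonoid σ.1 =>
            ‖f.coeff s‖ * x.val (Toric.chi k s)) (y.val f)) :=
  ⟨{x | Toric.IsGaussPoint x}, Toric.gaussRetraction k Δ, Toric.gaussHomeomorph,
    Toric.isClosed_setOf_isGaussPoint, Toric.isStrongDeformationRetraction_gaussRetraction,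
    fun _ => rfl, fun _ x => ⟨Toric.gaussPoint k (Toric.tropCone x), rfl,
      Toric.isGreatest_gaussPoint_tropCone x⟩⟩
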